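/- Let $R$ be a commutative ring with identity. A proper ideal $I$ of $R$ is called $n$-absorbing ($n$ a positive integer) if whenever $r_1\cdots r_{n+1}\in I$ with $r_1,\dots,r_{n+1}\in R$, there are $n$ of the $r_i$'s whose product is in $I$. Let $\omega_R(I)$ be the least positive integer $n$ such that $I$ is an $n$-absorbing ideal of $R$, and $\omega_R(I)=\infty$ if there is no such $n$. Let $I[X]$ (respectively $I[[X]]$) denote the ideal of $R[X]$ (respectively $R[[X]]$) consisting of all polynomials (respectively formal power series) all of whose coefficients lie in $I$. Suppose that $R$ is Noetherian and torsion-free, i.e. its additive group $(R,+)$ is torsion-free, and let $I$ be a radical ideal of $R$ (i.e. $\sqrt I=I$). Then \[\omega_{R[[X]]}(I[[X]])=\omega_{R[X]}(I[X])=\omega_R(I).\] -/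

import Mathlib

namespace AbsorbingIdeal

/-- A proper ideal `I` is `n`-absorbing if whenever a product of `n + 1` elements lies in `I`,
the product of some `n` of them (all but the `j`-th) already lies in `I`. -/
def IsNAbsorbing {R : Type*} [CommRing R] (n : ℕ) (I : Ideal R) : Prop :=
  I ≠ ⊤ ∧ ∀ r : Fin (n + 1) → R, ∏ i, r i ∈ I →
    ∃ j : Fin (n + 1), ∏ i ∈ Finset.univ.erase j, r i ∈ I

/-- `ω_R(I)`: the least positive integer `n` such that `I` is `n`-absorbing,
and `⊤` (that is, `∞`) if there is none. -/
noncomputable def omega {R : Type*} [CommRing R] (I : Ideal R) : ℕ∞ :=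
  sInf ((fun n : ℕ => (n : ℕ∞)) '' {n : ℕ | 0 < n ∧ IsNAbsorbing n I})

/-- `I[X]`: the ideal of all polynomials with every coefficient in `I`. -/
def polyIdeal {R : Type*} [CommRing R] (I : Ideal R) : Ideal (Polynomial R) where
  carrier := {f | ∀ k : ℕ, f.coeff k ∈ I}
  zero_mem' := fun k => by simp
  add_mem' := fun {f g} hf hg k => by
    rw [Polynomial.coeff_add]
    exact I.add_mem (hf k) (hg k)
  smul_mem' := fun c f hf k => by
    rw [smul_eq_mul, Polynomial.coeff_mul]
    exact I.sum_mem fun p _ => I.mul_mem_left _ (hf p.2)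

/-- `I[[X]]`: the ideal of all formal power series with every coefficient in `I`. -/
def powerSeriesIdeal {R : Type*} [CommRing R] (I : Ideal R) : Ideal (PowerSeries R) where
  carrier := {f | ∀ k : ℕ, PowerSeries.coeff k f ∈ I}
  zero_mem' := fun k => by simp
  add_mem' := fun {f g} hf hg k => by
    rw [map_add]
    exact I.add_mem (hf k) (hg k)
  smul_mem' := fun c f hf k => by
    rw [smul_eq_mul, PowerSeries.coeff_mul]
    exact I.sum_mem fun p _ => I.mul_mem_left _ (hf p.2)

end AbsorbingIdeal

/-! A radical ideal of a Noetherian ring is the intersection of its finitely many minimal primes,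
and `omega` of a finite nonempty intersection of pairwise incomparable primes is their number
(`omega_iInf_eq_card`). Passing to `P[X]` or `P[[X]]` preserves primality, incomparability and
intersections, so all three values count the minimal primes of `I`. -/

namespace AbsorbingIdeal

section PrimeIntersection

variable {S ι : Type*} [CommRing S] [Fintype ι]

/-- An intersection of `m` prime ideals is `m`-absorbing. -/
theorem isNAbsorbing_iInf_card [Nonempty ι] (P : ι → Ideal S) (hP : ∀ i, (P i).IsPrime) :
    IsNAbsorbing (Fintype.card ι) (⨅ i, P i) := by
  refine ⟨fun h => ?_, fun r hr => ?_⟩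
  · obtain ⟨i⟩ := ‹Nonempty ι›
    exact (hP i).ne_top (top_le_iff.1 (h ▸ iInf_le P i))
  · have h : ∀ i, ∃ k, r k ∈ P i := fun i => by
      have := hP i
      obtain ⟨k, -, hk⟩ := (Ideal.IsPrime.prod_mem_iff (p := P i)).1 (Ideal.mem_iInf.1 hr i)
      exact ⟨k, hk⟩
    choose f hf using h
    -- One factor per prime suffices, so among `m + 1` factors one is superfluous.
    obtain ⟨j, hj⟩ : ∃ j, ∀ i, f i ≠ j := by
      by_contra! hsurj
      have := Fintype.card_le_of_surjective f hsurj
      simp at this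
    refine ⟨j, Ideal.mem_iInf.2 fun i => ?_⟩
    exact Ideal.mem_of_dvd _ (Finset.dvd_prod_of_mem r (by simpa using hj i)) (hf i)

/-- Pairwise incomparable primes admit elements lying in exactly one of them. -/
theorem exists_mem_iff_eq_of_antichain (P : ι → Ideal S) (hP : ∀ i, (P i).IsPrime)
    (hinc : ∀ i j, P i ≤ P j → i = j) (i : ι) : ∃ a, ∀ j, a ∈ P j ↔ j = i := by
  classical
  by_contra! h
  -- Without such an element the other primes cover `P i`, and prime avoidance puts it inside one of
  -- them.
  have hsub : (P i : Set S) ⊆ ⋃ j ∈ (↑(Finset.univ.erase i) : Set ι), (P j : Set S) := by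
    intro a ha
    obtain ⟨j, hj⟩ := h a
    rcases hj with ⟨h1, h2⟩ | ⟨h1, rfl⟩
    · simp only [Set.mem_iUnion]
      exact ⟨j, by simpa using h2, h1⟩
    · exact absurd ha h1
  obtain ⟨j, hj, hle⟩ := (Ideal.subset_union_prime i i fun j _ _ _ => hP j).1 hsub
  exact (Finset.ne_of_mem_erase hj) (hinc i j hle).symm

/-- If an intersection of `m` pairwise incomparable primes is `n`-absorbing, then `m ≤ n`. -/
theorem card_le_of_isNAbsorbing_iInf (P : ι → Ideal S) (hP : ∀ i, (P i).IsPrime)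
    (hinc : ∀ i j, P i ≤ P j → i = j) {n : ℕ} (hn : IsNAbsorbing n (⨅ i, P i)) :
    Fintype.card ι ≤ n := by
  classical
  by_contra! hlt
  choose a ha using exists_mem_iff_eq_of_antichain P hP hinc
  obtain ⟨e⟩ : Nonempty (Fin (n + 1) ↪ ι) :=
    Function.Embedding.nonempty_of_card_le (by simpa using hlt)
  -- The fibres of `g` group the `a i` into `n + 1` nonempty blocks. Dropping the block of `i`
  -- removes the only factor in `P i`.
  obtain ⟨g, hg⟩ : ∃ g : ι → Fin (n + 1), Function.Surjective g :=
    ⟨Function.invFun e, Function.invFun_surjective e.injective⟩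
  obtain ⟨k, hk⟩ := hn.2 (fun k => ∏ i with g i = k, a i) (by
    rw [Finset.prod_fiberwise]
    exact Ideal.mem_iInf.2 fun i =>
      Ideal.mem_of_dvd _ (Finset.dvd_prod_of_mem a (Finset.mem_univ i)) ((ha i i).2 rfl))
  obtain ⟨i, rfl⟩ := hg k
  have := hP i
  obtain ⟨l, hl, hmem⟩ := (Ideal.IsPrime.prod_mem_iff (p := P i)).1 (Ideal.mem_iInf.1 hk i)
  obtain ⟨i', hi', hmem'⟩ := (Ideal.IsPrime.prod_mem_iff (p := P i)).1 hmem
  obtain rfl := (ha i' i).1 hmem'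
  exact Finset.ne_of_mem_erase hl (Finset.mem_filter.1 hi').2.symm

theorem omega_iInf_eq_card [Nonempty ι] (P : ι → Ideal S) (hP : ∀ i, (P i).IsPrime)
    (hinc : ∀ i j, P i ≤ P j → i = j) : omega (⨅ i, P i) = Fintype.card ι := by
  refine le_antisymm (sInf_le ⟨_, ⟨Fintype.card_pos, isNAbsorbing_iInf_card P hP⟩, rfl⟩)
    (le_sInf ?_)
  rintro _ ⟨n, ⟨-, hn⟩, rfl⟩
  exact Nat.cast_le.2 (card_le_of_isNAbsorbing_iInf P hP hinc hn)

theorem omega_top : omega (⊤ : Ideal S) = ⊤ := by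
  simp [omega, IsNAbsorbing]

end PrimeIntersection

variable {R : Type*} [CommRing R]

theorem mem_polyIdeal {I : Ideal R} {f : Polynomial R} :
    f ∈ polyIdeal I ↔ ∀ k, f.coeff k ∈ I := Iff.rfl

theorem mem_powerSeriesIdeal {I : Ideal R} {f : PowerSeries R} :
    f ∈ powerSeriesIdeal I ↔ ∀ k, PowerSeries.coeff k f ∈ I := Iff.rfl

theorem polyIdeal_eq_map (I : Ideal R) : polyIdeal I = I.map Polynomial.C :=
  Ideal.ext fun _ => Ideal.mem_map_C_iff.symm

/-- Yields primality: for `I` prime the target `(R/I)[[X]]` is a domain. -/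
theorem powerSeriesIdeal_eq_ker (I : Ideal R) :
    powerSeriesIdeal I = RingHom.ker (PowerSeries.map (Ideal.Quotient.mk I)) := by
  ext f
  simp [mem_powerSeriesIdeal, RingHom.mem_ker, PowerSeries.ext_iff, Ideal.Quotient.eq_zero_iff_mem]

theorem isPrime_polyIdeal {P : Ideal R} (hP : P.IsPrime) : (polyIdeal P).IsPrime :=
  polyIdeal_eq_map P ▸ Ideal.isPrime_map_C_of_isPrime

theorem isPrime_powerSeriesIdeal {P : Ideal R} (hP : P.IsPrime) :
    (powerSeriesIdeal P).IsPrime :=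
  powerSeriesIdeal_eq_ker P ▸ RingHom.ker_isPrime _

theorem le_of_polyIdeal_le {I J : Ideal R} (h : polyIdeal I ≤ polyIdeal J) : I ≤ J := by
  intro a ha
  have : Polynomial.C a ∈ polyIdeal I := fun k => by
    rw [Polynomial.coeff_C]; split_ifs <;> simp [ha]
  simpa using h this 0

theorem le_of_powerSeriesIdeal_le {I J : Ideal R}
    (h : powerSeriesIdeal I ≤ powerSeriesIdeal J) : I ≤ J := by
  intro a ha
  have : PowerSeries.C a ∈ powerSeriesIdeal I := fun k => by
    rw [PowerSeries.coeff_C]; split_ifs <;> simp [ha]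
  simpa using h this 0

theorem polyIdeal_iInf {ι : Type*} (P : ι → Ideal R) :
    polyIdeal (⨅ i, P i) = ⨅ i, polyIdeal (P i) := by
  ext f
  simp only [mem_polyIdeal, Ideal.mem_iInf]
  exact forall_comm

theorem powerSeriesIdeal_iInf {ι : Type*} (P : ι → Ideal R) :
    powerSeriesIdeal (⨅ i, P i) = ⨅ i, powerSeriesIdeal (P i) := by
  ext f
  simp only [mem_powerSeriesIdeal, Ideal.mem_iInf]
  exact forall_comm

theorem polyIdeal_top : polyIdeal (⊤ : Ideal R) = ⊤ :=
  top_le_iff.1 fun _ _ _ => Submodule.mem_top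

theorem powerSeriesIdeal_top : powerSeriesIdeal (⊤ : Ideal R) = ⊤ :=
  top_le_iff.1 fun _ _ _ => Submodule.mem_top

end AbsorbingIdeal

open AbsorbingIdeal in
theorem mainTheorem3 {R : Type*} [CommRing R] [IsNoetherianRing R] [IsAddTorsionFree R]
    (I : Ideal R) (hI : I.IsRadical) :
    AbsorbingIdeal.omega (AbsorbingIdeal.powerSeriesIdeal I) =
        AbsorbingIdeal.omega (AbsorbingIdeal.polyIdeal I) ∧
      AbsorbingIdeal.omega (AbsorbingIdeal.polyIdeal I) = AbsorbingIdeal.omega I := by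
  rcases eq_or_ne I ⊤ with rfl | hne
  -- The unit ideal is never absorbing, so all three values are `∞`.
  · simp [polyIdeal_top, powerSeriesIdeal_top, omega_top]
  let P : I.minimalPrimes → Ideal R := Subtype.val
  have : Fintype I.minimalPrimes := (I.finite_minimalPrimes_of_isNoetherianRing R).fintype
  have : Nonempty I.minimalPrimes := Ideal.nonempty_minimalPrimes hne
  have hIP : I = ⨅ i, P i := by
    rw [← sInf_eq_iInf', Ideal.sInf_minimalPrimes, hI.radical]
  have hP : ∀ i, (P i).IsPrime := fun i => i.2.1.1
  have hinc : ∀ i j, P i ≤ P j → i = j := fun i j h =>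
    Subtype.ext (le_antisymm h (j.2.2 i.2.1 h))
  rw [hIP, polyIdeal_iInf, powerSeriesIdeal_iInf, omega_iInf_eq_card P hP hinc,
    omega_iInf_eq_card _ (fun i => isPrime_polyIdeal (hP i))
      (fun i j h => hinc i j (le_of_polyIdeal_le h)),
    omega_iInf_eq_card _ (fun i => isPrime_powerSeriesIdeal (hP i))
      (fun i j h => hinc i j (le_of_powerSeriesIdeal_le h))]
  exact ⟨rfl, rfl⟩
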